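/- Let $1\le p\le n$ be integers, $K_1\ge 0$ and $K_2$ real. Consider networks of $n$ agents $x_1,\dots,x_n$ and $m$ sensors $y_1,\dots,y_m$, given by zero/free-parameter patterns (structural matrices) $[A]$ of size $n\times n$ and $[C]$ of size $m\times n$, such that every diagonal entry of $[A]$ is free (each agent has a self loop), every sensor measures exactly one agent (each row of $[C]$ has exactly one free entry) and no two sensors measure the same agent. Let $\|A\|_0$ be the number of free entries of $[A]$. For a set $F$ of compromised agents and sensors there is one attack input per element of $F$: $[B^a]$ has a free entry exactly where the input of a compromised agent enters the state equation of that agent, and $[D^a]$ exactly where the input of a compromised sensor enters the measurement of that sensor. A real system $(A,B,C,D)$ is left invertible if for $x(k+1)=Ax(k)+Bu(k)$, $y(k)=Cx(k)+Du(k)$, $x(0)=0$, having $y(k)=0$ for all $k\ge 0$ implies $u(k)=0$ for all $k\ge 0$; $([A],[B^a],[C],[D^a])$ is structurally left invertible if its realizations are left invertible for all values of the free parameters outside a set of Lebesgue measure $0$. Let $\mathcal F_{xy}$ be the family of all sets $F$ of at most $p$ agents and sensors, and $\mathcal F_x$ the family of all sets $F$ of at most $p$ agents (so that $[D^a]=0$).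 For $\mathcal F\in\{\mathcal F_{xy},\mathcal F_x\}$ consider the problem $$\min_{[A],[C],m} K_1\|A\|_0+K_2m\quad\text{s.t. } ([A],[B^a],[C],[D^a])\text{ is structurally left invertible for all }F\in\mathcal F,\quad m\in\{p,p+1,\dots,n\}.$$ 1. Let $\mathcal F=\mathcal F_{xy}$. For each $m\in\{p,\dots,n\}$ the minimum over $[A],[C]$ with $m$ fixed is attained and equals $K_1n(p+1)+(K_2-K_1)m$; the minimum of the joint problem is the minimum of this expression over $m\in\{p,\dots,n\}$. The set of optimal numbers of sensors $m^*$ is $\{p\}$ if $K_2>K_1$, $\{n\}$ if $K_2<K_1$, and $\{p,\dots,n\}$ if $K_2=K_1$. 2. Let $\mathcal F=\mathcal F_x$. For each $m\in\{p,\dots,n\}$ the minimum over $[A],[C]$ with $m$ fixed is attained and equals $K_1n(p+1)+(K_2-K_1p)m$; the minimum of the joint problem is the minimum of this expression over $m\in\{p,\dots,n\}$. The set of optimal numbers of sensors $m^*$ is $\{p\}$ if $K_2>K_1p$, $\{n\}$ if $K_2<K_1p$, and $\{p,\dots,n\}$ if $K_2=K_1p$. -/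

import Mathlib

open MeasureTheory

namespace DCS

/-- A structural matrix `[M]`: `M i j = true` says that the entry `(i, j)` is a free real
parameter (`[M]_{ij} ≠ 0`), `M i j = false` says that it is fixed to be zero. -/
abbrev StructMatrix (α β : Type) : Type := Matrix α β Bool

/-- The positions of the free parameters of a structural matrix. -/
abbrev StructMatrix.Free {α β : Type} (M : StructMatrix α β) : Type :=
  {e : α × β // M e.1 e.2 = true}

/-- `‖M‖₀`, the number of entries that are not fixed to be zero. -/
def StructMatrix.zeroNorm {α β : Type} [Fintype α] [Fintype β] (M : StructMatrix α β) : ℕ :=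
  Fintype.card M.Free

/-- The real matrix obtained by giving the free parameters the values `θ`. -/
noncomputable def StructMatrix.realize {α β : Type} (M : StructMatrix α β) (θ : M.Free → ℝ) :
    Matrix α β ℝ :=
  fun i j => if h : M i j = true then θ ⟨(i, j), h⟩ else 0

/-- Left invertibility of `x(k+1) = A x(k) + B u(k)`, `y(k) = C x(k) + D u(k)`: with `x(0) = 0`,
the output vanishes at all times only if the input vanishes at all times. -/
def IsLeftInvertible {X Y U : Type} [Fintype X] [Fintype U]
    (A : Matrix X X ℝ) (B : Matrix X U ℝ) (C : Matrix Y X ℝ) (D : Matrix Y U ℝ) : Prop :=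
  ∀ (u : ℕ → U → ℝ) (x : ℕ → X → ℝ), x 0 = 0 →
    (∀ k, x (k + 1) = A.mulVec (x k) + B.mulVec (u k)) →
    (∀ k, C.mulVec (x k) + D.mulVec (u k) = 0) →
    ∀ k, u k = 0

/-- Structural left invertibility: the admissible realizations that are not left invertible form
a Lebesgue null set in the space of all free parameters of the four structural matrices. -/
def IsStructLeftInvertible {X Y U : Type} [Fintype X] [Fintype Y] [Fintype U]
    (A : StructMatrix X X) (B : StructMatrix X U) (C : StructMatrix Y X)
    (D : StructMatrix Y U) : Prop :=
  ∀ᵐ θ : A.Free ⊕ B.Free ⊕ C.Free ⊕ D.Free → ℝ,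
    IsLeftInvertible
      (A.realize fun e => θ (Sum.inl e))
      (B.realize fun e => θ (Sum.inr (Sum.inl e)))
      (C.realize fun e => θ (Sum.inr (Sum.inr (Sum.inl e))))
      (D.realize fun e => θ (Sum.inr (Sum.inr (Sum.inr e))))

/-- A set of compromised nodes: agents are `Sum.inl i`, observers are `Sum.inr i`. -/
abbrev Attack (n m : ℕ) : Type := Finset (Fin n ⊕ Fin m)

/-- `[Bᵃ]`: there is one attack input for each compromised node, and the input of a compromised
agent enters the update of that agent only. -/
def attackB {n m : ℕ} (F : Attack n m) : StructMatrix (Fin n) F :=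
  fun i v => decide (v.1 = Sum.inl i)

/-- `[Dᵃ]`: the input of a compromised observer enters the measurement of that observer only. -/
def attackD {n m : ℕ} (F : Attack n m) : StructMatrix (Fin m) F :=
  fun i v => decide (v.1 = Sum.inr i)

/-- The attacks on at most `p` agents and observers. -/
def attacksXY (p n m : ℕ) : Set (Attack n m) := {F | F.card ≤ p}

/-- The attacks on at most `p` agents, with no observer attacked. -/
def attacksX (p n m : ℕ) : Set (Attack n m) := {F | F.card ≤ p ∧ ∀ v ∈ F, ∃ i, v = Sum.inl i}

/-- A network on `n` agents: the number `m` of sensors, the communication structure `[A]`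
(`A i j` is the link from agent `j` to agent `i`) and the sensor placement `[C]`. -/
structure Network (n : ℕ) where
  m : ℕ
  A : StructMatrix (Fin n) (Fin n)
  C : StructMatrix (Fin m) (Fin n)

/-- Every agent has a self loop, every observer measures exactly one agent, and no two observers
measure the same agent. -/
structure Network.IsAdmissible {n : ℕ} (N : Network n) : Prop where
  self_loop : ∀ i, N.A i i = true
  measures_one : ∀ i, ∃! j, N.C i j = true
  measures_distinct : ∀ i i' j, N.C i j = true → N.C i' j = true → i = i'

/-- The network is structurally left invertible under every attack of the family `𝓕`. -/
def Network.IsRobust {n : ℕ} (N : Network n) (𝓕 : (m : ℕ) → Set (Attack n m)) : Prop :=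
  ∀ F ∈ 𝓕 N.m, IsStructLeftInvertible N.A (attackB F) N.C (attackD F)

/-- The feasible points of the joint design problem. -/
def feasible (p n : ℕ) (𝓕 : (m : ℕ) → Set (Attack n m)) : Set (Network n) :=
  {N | N.IsAdmissible ∧ N.IsRobust 𝓕 ∧ p ≤ N.m ∧ N.m ≤ n}

/-- The objective `K₁ ‖A‖₀ + K₂ m`. -/
noncomputable def cost {n : ℕ} (K₁ K₂ : ℝ) (N : Network n) : ℝ :=
  K₁ * (N.A.zeroNorm : ℝ) + K₂ * (N.m : ℝ)

/-- The objective values of the feasible networks. -/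
def values (p n : ℕ) (K₁ K₂ : ℝ) (𝓕 : (m : ℕ) → Set (Attack n m)) : Set ℝ :=
  {c | ∃ N ∈ feasible p n 𝓕, c = cost K₁ K₂ N}

/-- The objective values of the feasible networks with exactly `m` sensors. -/
def valuesAt (p n m : ℕ) (K₁ K₂ : ℝ) (𝓕 : (m : ℕ) → Set (Attack n m)) : Set ℝ :=
  {c | ∃ N ∈ feasible p n 𝓕, N.m = m ∧ c = cost K₁ K₂ N}

/-- The optimal numbers of sensors: those of the feasible networks whose objective is minimal
among all feasible networks. -/
def optimalCounts (p n : ℕ) (K₁ K₂ : ℝ) (𝓕 : (m : ℕ) → Set (Attack n m)) : Set ℕ :=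
  {m | ∃ N ∈ feasible p n 𝓕, N.m = m ∧ ∀ N' ∈ feasible p n 𝓕, cost K₁ K₂ N ≤ cost K₁ K₂ N'}

end DCS

namespace DCS

/-! Everything is decided column by column. If an attack covers an agent `j`, every agent that `j`
feeds and every sensor on `j`, it can create a pulse at `j` and cancel all its effects
(`not_isStructLeftInvertible_of_outNeighbors_mem`). Robustness therefore forces column `j` of `[A]`,
plus `q` times column `j` of `[C]`, to have at least `p + 1` free entries, where `q = 1` if sensors
can be attacked and `q = p` if they cannot. As `[C]` has `m` free entries, summing over `j` gives
`‖A‖₀ + q m ≥ n (p + 1)`.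

Equality is reached by making `p` measured agents hubs. Only attacked agents without a healthy
sensor can hide a nonzero state, and the healthy hubs reveal it one step later through a generically
nonsingular block (`isStructLeftInvertible_of_free_block`). The counting in
`isStructLeftInvertible_of_hubs` shows that enough healthy hubs remain. For fixed `m` the optimum is
thus affine in `m`, and the sign of its slope `K₂ - K₁ q` decides the joint problem. -/

/-! ### Zero sets of real polynomials -/

theorem ae_eval_ne_zero_fin : ∀ {n : ℕ} (q : MvPolynomial (Fin n) ℝ), q ≠ 0 →
    ∀ᵐ x : Fin n → ℝ, MvPolynomial.eval x q ≠ 0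
  | 0, q, hq => by
    refine Filter.Eventually.of_forall fun x hx => hq ?_
    refine MvPolynomial.funext fun y => ?_
    rw [Subsingleton.elim y x, hx, map_zero]
  | n + 1, q, hq => by
    have hmeas : MeasurableSet {z : ℝ × (Fin n → ℝ) |
        MvPolynomial.eval (Fin.cons z.1 z.2 : Fin (n + 1) → ℝ) q ≠ 0} := by
      have hc : Continuous fun z : ℝ × (Fin n → ℝ) =>
          MvPolynomial.eval (Fin.cons z.1 z.2 : Fin (n + 1) → ℝ) q :=
        (MvPolynomial.continuous_eval q).comp (by fun_prop)
      exact (isClosed_singleton.preimage hc).isOpen_compl.measurableSet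
    have key : ∀ᵐ z : ℝ × (Fin n → ℝ),
        MvPolynomial.eval (Fin.cons z.1 z.2 : Fin (n + 1) → ℝ) q ≠ 0 := by
      -- Fubini with the distinguished variable innermost: where the leading coefficient does not
      -- vanish, only finitely many values of that variable are roots.
      rw [Measure.volume_eq_prod, Measure.ae_prod_iff_ae_ae hmeas, Measure.ae_ae_comm hmeas]
      have hlead : (MvPolynomial.finSuccEquiv ℝ n q).leadingCoeff ≠ 0 := by
        simpa using hq
      filter_upwards [ae_eval_ne_zero_fin _ hlead] with s hs
      have hne : (MvPolynomial.finSuccEquiv ℝ n q).map (MvPolynomial.eval s) ≠ 0 := by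
        intro h0
        apply hs
        have := congrArg
          (fun r => Polynomial.coeff r (MvPolynomial.finSuccEquiv ℝ n q).natDegree) h0
        simpa [Polynomial.coeff_map] using this
      have hfin := Polynomial.finite_setOfPred_isRoot hne
      filter_upwards [hfin.countable.ae_notMem volume] with y hy
      rw [MvPolynomial.eval_eq_eval_mv_eval']
      exact hy
    have h2 := (volume_preserving_piFinSuccAbove
      (fun _ : Fin (n + 1) => ℝ) 0).quasiMeasurePreserving.ae key
    filter_upwards [h2] with x hx
    simpa [MeasurableEquiv.piFinSuccAbove, Fin.insertNthEquiv, Fin.removeNth] using hx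

/-- The zero set of a nonzero real polynomial is Lebesgue null. -/
theorem ae_eval_ne_zero {ι : Type*} [Fintype ι] {q : MvPolynomial ι ℝ} (hq : q ≠ 0) :
    ∀ᵐ x : ι → ℝ, MvPolynomial.eval x q ≠ 0 := by
  let e := Fintype.equivFin ι
  have hq' : MvPolynomial.rename e q ≠ 0 := by
    rwa [Ne, map_eq_zero_iff _ (MvPolynomial.rename_injective _ e.injective)]
  have h := (volume_measurePreserving_piCongrLeft
    (fun _ : Fin (Fintype.card ι) => ℝ) e).quasiMeasurePreserving.ae
    (ae_eval_ne_zero_fin _ hq')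
  filter_upwards [h] with x hx
  rw [MvPolynomial.eval_rename] at hx
  convert hx using 3
  funext i
  simp [MeasurableEquiv.coe_piCongrLeft, Equiv.piCongrLeft_apply]

/-! ### Realizations of structural matrices -/

theorem StructMatrix.realize_apply_of_false {α β : Type} {M : StructMatrix α β} {i : α} {j : β}
    (h : ¬ M i j = true) (θ : M.Free → ℝ) : M.realize θ i j = 0 := dif_neg h

theorem StructMatrix.realize_apply_of_true {α β : Type} {M : StructMatrix α β} {i : α} {j : β}
    (h : M i j = true) (θ : M.Free → ℝ) : M.realize θ i j = θ ⟨(i, j), h⟩ := dif_pos h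

/-- A row whose only possibly free entry is in column `j`. -/
theorem StructMatrix.realize_mulVec_of_unique {α β : Type} [Fintype β] {M : StructMatrix α β}
    {i : α} {j : β} (h : ∀ k, M i k = true → k = j) (θ : M.Free → ℝ) (v : β → ℝ) :
    (M.realize θ).mulVec v i = M.realize θ i j * v j := by
  rw [Matrix.mulVec, dotProduct]
  refine Finset.sum_eq_single j (fun k _ hk => ?_) (fun hj => absurd (Finset.mem_univ j) hj)
  rw [StructMatrix.realize_apply_of_false (fun hM => hk (h k hM)), zero_mul]

theorem StructMatrix.realize_mulVec_of_forall_false {α β : Type} [Fintype β]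
    {M : StructMatrix α β} {i : α} (h : ∀ k, ¬ M i k = true) (θ : M.Free → ℝ) (v : β → ℝ) :
    (M.realize θ).mulVec v i = 0 := by
  rw [Matrix.mulVec, dotProduct]
  refine Finset.sum_eq_zero fun k _ => ?_
  rw [StructMatrix.realize_apply_of_false (h k), zero_mul]

/-! ### Criteria for structural left invertibility under attack -/

section Attack

variable {n m : ℕ} {F : Attack n m}

theorem attackB_mulVec_of_mem {i : Fin n} (h : Sum.inl i ∈ F)
    (θ : (attackB F).Free → ℝ) (u : F → ℝ) :
    ((attackB F).realize θ).mulVec u i =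
      (attackB F).realize θ i ⟨Sum.inl i, h⟩ * u ⟨Sum.inl i, h⟩ :=
  StructMatrix.realize_mulVec_of_unique
    (fun _ hk => Subtype.ext (of_decide_eq_true hk)) θ u

theorem attackD_mulVec_of_mem {i : Fin m} (h : Sum.inr i ∈ F)
    (θ : (attackD F).Free → ℝ) (u : F → ℝ) :
    ((attackD F).realize θ).mulVec u i =
      (attackD F).realize θ i ⟨Sum.inr i, h⟩ * u ⟨Sum.inr i, h⟩ :=
  StructMatrix.realize_mulVec_of_unique
    (fun _ hk => Subtype.ext (of_decide_eq_true hk)) θ u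

theorem attackB_mulVec_of_notMem {i : Fin n} (h : Sum.inl i ∉ F)
    (θ : (attackB F).Free → ℝ) (u : F → ℝ) : ((attackB F).realize θ).mulVec u i = 0 :=
  StructMatrix.realize_mulVec_of_forall_false (M := attackB F) (i := i)
    (fun (k : F) hk => h ((of_decide_eq_true hk : k.1 = Sum.inl i) ▸ k.2)) θ u

theorem attackD_mulVec_of_notMem {i : Fin m} (h : Sum.inr i ∉ F)
    (θ : (attackD F).Free → ℝ) (u : F → ℝ) : ((attackD F).realize θ).mulVec u i = 0 :=
  StructMatrix.realize_mulVec_of_forall_false (M := attackD F) (i := i)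
    (fun (k : F) hk => h ((of_decide_eq_true hk : k.1 = Sum.inr i) ▸ k.2)) θ u

/-- The generic square submatrix on the rows `r` and columns `c`, all of whose entries are free,
is nonsingular. -/
theorem ae_det_ne_zero {ι κ : Type*} [Fintype ι] [Fintype κ] [DecidableEq κ]
    (f : κ × κ → ι) (hf : Function.Injective f) :
    ∀ᵐ θ : ι → ℝ, (Matrix.of fun i j => θ (f (i, j))).det ≠ 0 := by
  have hq : MvPolynomial.rename f (Matrix.mvPolynomialX κ κ ℝ).det ≠ 0 := by
    rw [Ne, map_eq_zero_iff _ (MvPolynomial.rename_injective _ hf)]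
    exact Matrix.det_mvPolynomialX_ne_zero κ ℝ
  filter_upwards [ae_eval_ne_zero hq] with θ hθ
  rwa [MvPolynomial.eval_rename, Matrix.eval_det_mvPolynomialX] at hθ

theorem ae_forall_ne_zero (ι : Type*) [Fintype ι] : ∀ᵐ θ : ι → ℝ, ∀ i, θ i ≠ 0 := by
  rw [ae_all_iff]
  intro i
  filter_upwards [ae_eval_ne_zero (MvPolynomial.X_ne_zero (R := ℝ) i)] with θ hθ
  simpa using hθ

/-- If the exposed agents `Z` (the attacked agents without a healthy sensor) send free links to
every member of a set `W` of unattacked agents with healthy sensors, and `W` is at least as large as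
`Z`, then the network is structurally left invertible. -/
theorem isStructLeftInvertible_of_free_block {A : StructMatrix (Fin n) (Fin n)}
    {C : StructMatrix (Fin m) (Fin n)} (hC : ∀ i, ∃! j, C i j = true) {Z W : Finset (Fin n)}
    (hZ : ∀ j, Sum.inl j ∈ F → (∀ i, C i j = true → Sum.inr i ∈ F) → j ∈ Z)
    (hW : ∀ w ∈ W, Sum.inl w ∉ F ∧ ∃ i, C i w = true ∧ Sum.inr i ∉ F)
    (hcard : Z.card ≤ W.card) (hA : ∀ w ∈ W, ∀ z ∈ Z, A w z = true) :
    IsStructLeftInvertible A (attackB F) C (attackD F) := by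
  obtain ⟨σ⟩ : Nonempty (Z ↪ W) := Function.Embedding.nonempty_of_card_le (by simpa using hcard)
  -- A square block of `[A]`, with columns `Z` and rows chosen in `W` by `σ`; its entries are
  -- distinct free parameters, so its determinant is generically nonzero.
  let f : Z × Z → A.Free ⊕ (attackB F).Free ⊕ C.Free ⊕ (attackD F).Free := fun e =>
    Sum.inl ⟨((σ e.1).1, e.2.1), hA _ (σ e.1).2 _ e.2.2⟩
  have hf : Function.Injective f := by
    rintro ⟨a, b⟩ ⟨a', b'⟩ h
    simp only [f, Sum.inl.injEq, Subtype.mk.injEq, Prod.mk.injEq] at h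
    have h1 := σ.injective (Subtype.ext h.1)
    have h2 := Subtype.ext h.2
    exact Prod.ext h1 h2
  filter_upwards [ae_det_ne_zero f hf, ae_forall_ne_zero _] with θ hdet hne u x hx0 hx hy
  have hmeas : ∀ k j i, C i j = true → Sum.inr i ∉ F → x k j = 0 := by
    intro k j i hij hi
    have h := congrFun (hy k) i
    rw [Pi.add_apply, attackD_mulVec_of_notMem hi, add_zero,
      StructMatrix.realize_mulVec_of_unique (j := j)
        (fun l hl => (hC i).unique hl hij), StructMatrix.realize_apply_of_true hij] at h
    exact (mul_eq_zero.1 h).resolve_left (hne _)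
  have hupd : ∀ k i, Sum.inl i ∉ F →
      x (k + 1) i = (A.realize fun e => θ (Sum.inl e)).mulVec (x k) i := by
    intro k i hi
    have h := congrFun (hx k) i
    rwa [Pi.add_apply, attackB_mulVec_of_notMem hi, add_zero] at h
  have hxz : ∀ k, x k = 0 := by
    intro k
    induction k with
    | zero => exact hx0
    | succ k ih =>
      -- Off `Z`, an attacked agent is seen by a healthy sensor, and an unattacked one is updated
      -- from the zero state.
      have hout : ∀ j, j ∉ Z → x (k + 1) j = 0 := by
        intro j hj
        by_cases hjF : Sum.inl j ∈ F
        · by_contra hne'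
          refine hj (hZ j hjF fun i hij => ?_)
          by_contra hi
          exact hne' (hmeas _ j i hij hi)
        · rw [hupd k j hjF, ih, Matrix.mulVec_zero, Pi.zero_apply]
      -- The agents of `W` are unattacked and measured as zero at time `k + 2`, which gives linear
      -- equations on the state of `Z` at time `k + 1`.
      have hker : (Matrix.of fun i j : Z => θ (f (i, j))).mulVec (fun z => x (k + 1) z.1) = 0 := by
        funext z
        obtain ⟨hw, i, hi, hiF⟩ := hW _ (σ z).2
        have h := hupd (k + 1) _ hw
        rw [hmeas _ _ i hi hiF, Matrix.mulVec, dotProduct,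
          ← Finset.sum_subset (Finset.subset_univ Z)
            (fun j _ hj => by rw [hout j hj, mul_zero]), ← Finset.sum_coe_sort] at h
        rw [Matrix.mulVec, dotProduct, Pi.zero_apply, h]
        refine Finset.sum_congr rfl fun j _ => ?_
        rw [StructMatrix.realize_apply_of_true (hA _ (σ z).2 _ j.2)]
        rfl
      have hin := Matrix.eq_zero_of_mulVec_eq_zero hdet hker
      funext j
      by_cases hj : j ∈ Z
      · exact congrFun hin ⟨j, hj⟩
      · exact hout j hj
  intro k
  have hBu := hx k
  have hDu := hy k
  rw [hxz k, hxz (k + 1), Matrix.mulVec_zero, zero_add] at hBu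
  rw [hxz k, Matrix.mulVec_zero, zero_add] at hDu
  funext ⟨v, hv⟩
  rcases v with i | i
  · have h := congrFun hBu i
    rw [attackB_mulVec_of_mem hv, StructMatrix.realize_apply_of_true (by simp [attackB])] at h
    exact (mul_eq_zero.1 h.symm).resolve_left (hne _)
  · have h := congrFun hDu i
    rw [attackD_mulVec_of_mem hv, StructMatrix.realize_apply_of_true (by simp [attackD])] at h
    exact (mul_eq_zero.1 h).resolve_left (hne _)

/-- An attack that covers an agent `j`, all the other agents it is linked to and all the sensors
measuring it destroys structural left invertibility. -/
theorem not_isStructLeftInvertible_of_outNeighbors_mem {A : StructMatrix (Fin n) (Fin n)}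
    {C : StructMatrix (Fin m) (Fin n)} {j : Fin n} (hj : Sum.inl j ∈ F)
    (hAF : ∀ i, A i j = true → Sum.inl i ∈ F) (hCF : ∀ i, C i j = true → Sum.inr i ∈ F) :
    ¬ IsStructLeftInvertible A (attackB F) C (attackD F) := by
  intro h
  obtain ⟨θ, hinv, hne⟩ := (h.and (ae_forall_ne_zero _)).exists
  set A' := A.realize fun e => θ (Sum.inl e)
  set B' := (attackB F).realize fun e => θ (Sum.inr (Sum.inl e)) with hB'
  set C' := C.realize fun e => θ (Sum.inr (Sum.inr (Sum.inl e)))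
  set D' := (attackD F).realize fun e => θ (Sum.inr (Sum.inr (Sum.inr e))) with hD'
  have hb : ∀ i (hi : Sum.inl i ∈ F), B' i ⟨Sum.inl i, hi⟩ ≠ 0 := by
    intro i hi
    rw [hB', StructMatrix.realize_apply_of_true (by simp [attackB])]
    exact hne _
  have hd : ∀ i (hi : Sum.inr i ∈ F), D' i ⟨Sum.inr i, hi⟩ ≠ 0 := by
    intro i hi
    rw [hD', StructMatrix.realize_apply_of_true (by simp [attackD])]
    exact hne _
  -- A unit pulse at `j`, at time `1` because the state at time `0` must vanish; the input `u` is
  -- solved from the dynamics and the zero output.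
  let x : ℕ → Fin n → ℝ := fun k => if k = 1 then Pi.single j 1 else 0
  let u : ℕ → F → ℝ := fun k v => match v with
    | ⟨Sum.inl i, hi⟩ => (B' i ⟨Sum.inl i, hi⟩)⁻¹ * (x (k + 1) - A'.mulVec (x k)) i
    | ⟨Sum.inr i, hi⟩ => (D' i ⟨Sum.inr i, hi⟩)⁻¹ * -(C'.mulVec (x k) i)
  have hu := hinv u x (by simp [x]) (fun k => by
    funext i
    by_cases hi : Sum.inl i ∈ F
    · rw [Pi.add_apply, attackB_mulVec_of_mem hi, mul_inv_cancel_left₀ (hb i hi), Pi.sub_apply]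
      ring
    · have hij : i ≠ j := fun h => hi (h ▸ hj)
      have hAij : A' i j = 0 := StructMatrix.realize_apply_of_false (fun h => hi (hAF i h)) _
      rw [Pi.add_apply, attackB_mulVec_of_notMem hi]
      by_cases hk : k = 1
      · simp [x, hk, hAij]
      · by_cases hk0 : k = 0
        · simp [x, hk0, hij]
        · simp [x, hk, hk0]) (fun k => by
    funext i
    by_cases hi : Sum.inr i ∈ F
    · rw [Pi.add_apply, attackD_mulVec_of_mem hi, mul_inv_cancel_left₀ (hd i hi), Pi.zero_apply]
      ring
    · have hCij : C' i j = 0 := StructMatrix.realize_apply_of_false (fun h => hi (hCF i h)) _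
      rw [Pi.add_apply, attackD_mulVec_of_notMem hi]
      by_cases hk : k = 1
      · simp [x, hk, hCij]
      · simp [x, hk])
  have h0 := congrFun (hu 0) ⟨Sum.inl j, hj⟩
  have h1 : (B' j ⟨Sum.inl j, hj⟩)⁻¹ * (x (0 + 1) - A'.mulVec (x 0)) j = 0 := h0
  rw [mul_eq_zero, or_iff_right (inv_ne_zero (hb j hj))] at h1
  simp [x] at h1

end Attack

/-! ### Lower bounds on the columns -/

theorem StructMatrix.zeroNorm_eq_sum_col {α β : Type} [Fintype α] [Fintype β]
    (M : StructMatrix α β) : M.zeroNorm = ∑ j, (Finset.univ.filter fun i => M i j = true).card := by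
  rw [StructMatrix.zeroNorm, Fintype.card_subtype, Finset.card_filter,
    Fintype.sum_prod_type_right]
  exact Finset.sum_congr rfl fun j _ => (Finset.card_filter _ _).symm

theorem StructMatrix.zeroNorm_eq_sum_row {α β : Type} [Fintype α] [Fintype β]
    (M : StructMatrix α β) : M.zeroNorm = ∑ i, (Finset.univ.filter fun j => M i j = true).card := by
  rw [StructMatrix.zeroNorm, Fintype.card_subtype, Finset.card_filter, Fintype.sum_prod_type]
  exact Finset.sum_congr rfl fun i _ => (Finset.card_filter _ _).symm

theorem Network.IsAdmissible.zeroNorm_C {n : ℕ} {N : Network n} (hN : N.IsAdmissible) :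
    N.C.zeroNorm = N.m := by
  rw [StructMatrix.zeroNorm_eq_sum_row]
  have h : ∀ i, (Finset.univ.filter fun j => N.C i j = true).card = 1 := by
    intro i
    obtain ⟨j, hj, huniq⟩ := hN.measures_one i
    rw [Finset.card_eq_one]
    exact ⟨j, Finset.ext fun k => by simpa using ⟨huniq k, fun h => h ▸ hj⟩⟩
  simp [h]

/-- Otherwise the out-neighbors of `j`, with `j` itself by its self loop, and the sensors on `j`
form an admissible attack that conceals a pulse at `j`. -/
theorem Network.IsAdmissible.le_card_col_of_isRobust_attacksXY {n p : ℕ} {N : Network n}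
    (hN : N.IsAdmissible) (hR : N.IsRobust (attacksXY p n)) (j : Fin n) :
    p + 1 ≤ (Finset.univ.filter fun i => N.A i j = true).card +
      (Finset.univ.filter fun i => N.C i j = true).card := by
  by_contra hlt
  refine not_isStructLeftInvertible_of_outNeighbors_mem (j := j) ?_ ?_ ?_
    (hR (Finset.disjSum (Finset.univ.filter fun i => N.A i j = true)
      (Finset.univ.filter fun i => N.C i j = true)) ?_)
  · simp [hN.self_loop]
  · simp
  · simp
  · rw [attacksXY, Set.mem_ofPred_eq, Finset.card_disjSum]
    omega

/-- If `j` is measured, the self loop and one sensor already suffice. If not, attacking its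
out-neighbors conceals a pulse without touching any sensor. -/
theorem Network.IsAdmissible.le_card_col_of_isRobust_attacksX {n p : ℕ} {N : Network n}
    (hN : N.IsAdmissible) (hR : N.IsRobust (attacksX p n)) (j : Fin n) :
    p + 1 ≤ (Finset.univ.filter fun i => N.A i j = true).card +
      p * (Finset.univ.filter fun i => N.C i j = true).card := by
  by_cases hj : ∃ i, N.C i j = true
  · obtain ⟨i, hi⟩ := hj
    have h1 : 0 < (Finset.univ.filter fun i => N.A i j = true).card :=
      Finset.card_pos.2 ⟨j, by simp [hN.self_loop]⟩
    have h2 : 0 < (Finset.univ.filter fun i => N.C i j = true).card :=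
      Finset.card_pos.2 ⟨i, by simp [hi]⟩
    have h3 := Nat.le_mul_of_pos_right p h2
    omega
  · push Not at hj
    by_contra hlt
    refine not_isStructLeftInvertible_of_outNeighbors_mem (j := j) ?_ ?_ ?_
      (hR (Finset.disjSum (Finset.univ.filter fun i => N.A i j = true) ∅) ⟨?_, ?_⟩)
    · simp [hN.self_loop]
    · simp
    · exact fun i hi => absurd hi (hj i)
    · rw [Finset.card_disjSum, Finset.card_empty]
      omega
    · intro v hv
      rcases v with i | i
      · exact ⟨i, rfl⟩
      · simp at hv

/-! ### Optimal networks built from hubs -/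

/-- The sensor placement in which the agents `0, …, m - 1` are measured. -/
def firstSensors (n m : ℕ) : StructMatrix (Fin m) (Fin n) := fun i j => decide (i.val = j.val)

/-- Links from every agent to `p` hubs, or to `p - 1` of them if the agent is measured. -/
def hubLinksXY (p n m : ℕ) : StructMatrix (Fin n) (Fin n) := fun i j =>
  decide (i = j ∨ i.val < p ∧ (i.val + 1 = p → j.val < p ∨ m ≤ j.val))

/-- Links from every agent that is not measured to `p` hubs. -/
def hubLinksX (p n m : ℕ) : StructMatrix (Fin n) (Fin n) := fun i j =>
  decide (i = j ∨ i.val < p ∧ m ≤ j.val)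

section Hub

variable {p n m : ℕ}

theorem isAdmissible_firstSensors (hmn : m ≤ n) {A : StructMatrix (Fin n) (Fin n)}
    (hA : ∀ i, A i i = true) : Network.IsAdmissible ⟨m, A, firstSensors n m⟩ where
  self_loop := hA
  measures_one i := ⟨Fin.castLE hmn i, by simp [firstSensors], fun j hj => by
    have := of_decide_eq_true hj
    exact Fin.ext this.symm⟩
  measures_distinct i i' j h h' := by
    have h1 := of_decide_eq_true h
    have h2 := of_decide_eq_true h'
    exact Fin.ext (h1.trans h2.symm)

theorem card_col_firstSensors (j : Fin n) :
    (Finset.univ.filter fun i => firstSensors n m i j = true).card = if j.val < m then 1 else 0 := by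
  split_ifs with h
  · rw [Finset.card_eq_one]
    exact ⟨⟨j, h⟩, Finset.ext fun i => by simp [firstSensors, Fin.ext_iff]⟩
  · rw [Finset.card_eq_zero, Finset.filter_eq_empty_iff]
    intro i _
    have := i.2
    simp only [firstSensors, decide_eq_true_eq]
    omega

theorem card_filter_val_lt (hpn : p ≤ n) :
    (Finset.univ.filter fun i : Fin n => i.val < p).card = p := by
  rw [Fin.card_filter_val_lt, min_eq_right hpn]

theorem card_col_hubLinksXY (hp : 1 ≤ p) (hpm : p ≤ m) (hmn : m ≤ n) (j : Fin n) :
    (Finset.univ.filter fun i => hubLinksXY p n m i j = true).card +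
      (Finset.univ.filter fun i => firstSensors n m i j = true).card = p + 1 := by
  rw [card_col_firstSensors]
  by_cases h1 : j.val < p
  · have h : (Finset.univ.filter fun i => hubLinksXY p n m i j = true) =
        Finset.univ.filter fun i : Fin n => i.val < p := by
      ext i
      simp only [hubLinksXY, decide_eq_true_eq, Finset.mem_filter_univ, Fin.ext_iff]
      omega
    rw [h, card_filter_val_lt (hpm.trans hmn), if_pos (h1.trans_le hpm)]
  · by_cases h2 : j.val < m
    · have h : (Finset.univ.filter fun i => hubLinksXY p n m i j = true) =
          insert j (Finset.univ.filter fun i : Fin n => i.val < p - 1) := by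
        ext i
        simp only [hubLinksXY, decide_eq_true_eq, Finset.mem_filter_univ, Finset.mem_insert,
          Fin.ext_iff]
        omega
      rw [h, Finset.card_insert_of_notMem (by simp; omega), card_filter_val_lt (by omega),
        if_pos h2]
      omega
    · have h : (Finset.univ.filter fun i => hubLinksXY p n m i j = true) =
          insert j (Finset.univ.filter fun i : Fin n => i.val < p) := by
        ext i
        simp only [hubLinksXY, decide_eq_true_eq, Finset.mem_filter_univ, Finset.mem_insert,
          Fin.ext_iff]
        omega
      rw [h, Finset.card_insert_of_notMem (by simp; omega), card_filter_val_lt (by omega),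
        if_neg h2]

theorem card_col_hubLinksX (hpm : p ≤ m) (hmn : m ≤ n) (j : Fin n) :
    (Finset.univ.filter fun i => hubLinksX p n m i j = true).card +
      p * (Finset.univ.filter fun i => firstSensors n m i j = true).card = p + 1 := by
  rw [card_col_firstSensors]
  by_cases h2 : j.val < m
  · have h : (Finset.univ.filter fun i => hubLinksX p n m i j = true) = {j} := by
      ext i
      simp only [hubLinksX, decide_eq_true_eq, Finset.mem_filter_univ, Finset.mem_singleton,
        Fin.ext_iff]
      omega
    rw [h, Finset.card_singleton, if_pos h2, mul_one, add_comm]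
  · have h : (Finset.univ.filter fun i => hubLinksX p n m i j = true) =
        insert j (Finset.univ.filter fun i : Fin n => i.val < p) := by
      ext i
      simp only [hubLinksX, decide_eq_true_eq, Finset.mem_filter_univ, Finset.mem_insert,
        Fin.ext_iff]
      omega
    rw [h, Finset.card_insert_of_notMem (by simp; omega), card_filter_val_lt (by omega),
      if_neg h2, mul_zero, add_zero]

/-- The agents whose sensor is attacked, when the agents `0, …, m - 1` are measured. -/
def sensorAttacked (hmn : m ≤ n) (F : Attack n m) : Finset (Fin n) :=
  F.toRight.map (Fin.castLEEmb hmn)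

theorem card_sensorAttacked (hmn : m ≤ n) (F : Attack n m) :
    F.toLeft.card + (sensorAttacked hmn F).card = F.card := by
  rw [sensorAttacked, Finset.card_map, Finset.card_toLeft_add_card_toRight]

theorem mem_sensorAttacked_of_lt (hmn : m ≤ n) {F : Attack n m} {i : Fin n} (hi : i.val < m) :
    i ∈ sensorAttacked hmn F ↔ Sum.inr ⟨i.val, hi⟩ ∈ F := by
  rw [sensorAttacked, Finset.mem_map]
  constructor
  · rintro ⟨s, hs, rfl⟩
    simpa using hs
  · exact fun h => ⟨⟨i, hi⟩, by simpa using h, rfl⟩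

/-- Every hub in `Q` is measured since `p ≤ m`. Those with neither agent nor sensor attacked serve
as `W`, and `hcard` makes them at least as many as the exposed agents. -/
theorem isStructLeftInvertible_of_hubs (hpm : p ≤ m) (hmn : m ≤ n)
    {A : StructMatrix (Fin n) (Fin n)} {F : Attack n m} (Q : Finset (Fin n))
    (hQ : ∀ w ∈ Q, w.val < p)
    (hA : ∀ w ∈ Q, ∀ z, z ∈ F.toLeft → (z.val < m → z ∈ sensorAttacked hmn F) → A w z = true)
    (hcard : F.toLeft.card + ((sensorAttacked hmn F).filter fun i => i.val < p).card ≤ Q.card) :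
    IsStructLeftInvertible A (attackB F) (firstSensors n m) (attackD F) := by
  set S := sensorAttacked hmn F with hS
  have hZ : ∀ z, z ∈ F.toLeft.filter (fun z => z.val < m → z ∈ S) ↔
      z ∈ F.toLeft ∧ (z.val < m → z ∈ S) := fun z => Finset.mem_filter
  refine isStructLeftInvertible_of_free_block
    (Z := F.toLeft.filter fun z => z.val < m → z ∈ S) (W := Q \ (F.toLeft ∪ S))
    (fun i => (isAdmissible_firstSensors (A := fun _ _ => true) hmn fun _ => rfl).measures_one i)
    ?_ ?_ ?_ ?_
  · intro j hj hCj
    rw [hZ]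
    refine ⟨Finset.mem_toLeft.2 hj, fun hjm => ?_⟩
    rw [hS, mem_sensorAttacked_of_lt hmn hjm]
    exact hCj _ (by simp [firstSensors])
  · intro w hw
    rw [Finset.mem_sdiff, Finset.mem_union, not_or, Finset.mem_toLeft] at hw
    have hwm : w.val < m := (hQ w hw.1).trans_le hpm
    rw [hS, mem_sensorAttacked_of_lt hmn hwm] at hw
    exact ⟨hw.2.1, ⟨w, hwm⟩, by simp [firstSensors], hw.2.2⟩
  · have h1 : Q.card ≤ (Q \ (F.toLeft ∪ S)).card + (Q ∩ (F.toLeft ∪ S)).card :=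
      (Finset.card_sdiff_add_card_inter _ _).ge
    -- Compare unions and intersections: an exposed agent lying in `Q` is a measured hub, so both it
    -- and its sensor are attacked and it is counted twice on the right as well.
    have h2 : (F.toLeft.filter fun z => z.val < m → z ∈ S).card + (Q ∩ (F.toLeft ∪ S)).card ≤
        F.toLeft.card + (S.filter fun i => i.val < p).card := by
      rw [← Finset.card_union_add_card_inter, ← Finset.card_union_add_card_inter F.toLeft]
      refine add_le_add (Finset.card_le_card ?_) (Finset.card_le_card ?_)
      · intro i hi
        have := hQ i
        simp only [Finset.mem_union, Finset.mem_inter, Finset.mem_filter] at hi ⊢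
        tauto
      · intro i hi
        have h3 := hQ i
        have h4 : i.val < p → i.val < m := fun h => h.trans_le hpm
        simp only [Finset.mem_union, Finset.mem_inter, Finset.mem_filter] at hi ⊢
        tauto
    omega
  · intro w hw z hz
    rw [hZ] at hz
    exact hA w (Finset.mem_sdiff.1 hw).1 z hz.1 hz.2

/-- The last hub receives no links from the measured non-hubs. It is needed only when no non-hub has
its sensor attacked, and then no measured non-hub is exposed. Otherwise one attack is spent away
from the hubs, and the first `p - 1` hubs, to which everyone links, are enough. -/
theorem isRobust_hubLinksXY (hp : 1 ≤ p) (hpm : p ≤ m) (hmn : m ≤ n) :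
    Network.IsRobust ⟨m, hubLinksXY p n m, firstSensors n m⟩ (attacksXY p n) := by
  intro F hF
  have hF' : F.card ≤ p := hF
  rw [← card_sensorAttacked hmn F] at hF'
  have hle := Finset.card_filter_le (sensorAttacked hmn F) (fun i => i.val < p)
  by_cases hz : ∃ z ∈ sensorAttacked hmn F, p ≤ z.val
  · refine isStructLeftInvertible_of_hubs hpm hmn (Finset.univ.filter fun i => i.val < p - 1)
      (fun w hw => ?_) (fun w hw z _ _ => ?_) ?_
    · rw [Finset.mem_filter_univ] at hw
      omega
    · rw [Finset.mem_filter_univ] at hw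
      simp only [hubLinksXY, decide_eq_true_eq]
      omega
    · rw [card_filter_val_lt (by omega)]
      obtain ⟨z, hzS, hzp⟩ := hz
      have : ((sensorAttacked hmn F).filter fun i => i.val < p).card <
          (sensorAttacked hmn F).card :=
        Finset.card_lt_card (Finset.filter_ssubset.2 ⟨z, hzS, by omega⟩)
      omega
  · push Not at hz
    refine isStructLeftInvertible_of_hubs hpm hmn (Finset.univ.filter fun i => i.val < p)
      (fun w hw => (Finset.mem_filter_univ w).1 hw) (fun w hw z _ hzS => ?_) ?_
    · rw [Finset.mem_filter_univ] at hw
      have h1 : z.val < m → z.val < p := fun h => hz z (hzS h)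
      simp only [hubLinksXY, decide_eq_true_eq]
      omega
    · rw [card_filter_val_lt (by omega)]
      omega

/-- With all sensors healthy, only unmeasured agents can be exposed, and these link to all `p` hubs.
-/
theorem isRobust_hubLinksX (hpm : p ≤ m) (hmn : m ≤ n) :
    Network.IsRobust ⟨m, hubLinksX p n m, firstSensors n m⟩ (attacksX p n) := by
  intro F hF
  have hF' : F.card ≤ p := hF.1
  rw [← card_sensorAttacked hmn F] at hF'
  have hle := Finset.card_filter_le (sensorAttacked hmn F) (fun i => i.val < p)
  refine isStructLeftInvertible_of_hubs hpm hmn (Finset.univ.filter fun i => i.val < p)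
    (fun w hw => (Finset.mem_filter_univ w).1 hw) (fun w hw z _ hzS => ?_) ?_
  · rw [Finset.mem_filter_univ] at hw
    have h1 : ¬ z.val < m := by
      intro h
      have h2 := hzS h
      rw [mem_sensorAttacked_of_lt hmn h] at h2
      obtain ⟨i, hi⟩ := hF.2 _ h2
      simp at hi
    simp only [hubLinksX, decide_eq_true_eq]
    omega
  · rw [card_filter_val_lt (by omega)]
    omega

end Hub

/-! ### Minimum for fixed `m` and the joint problem -/

/-- The fixed-`m` minimum, for a family of attacks under which every column of `[A]` must have at
least `p + 1` free entries, an entry in the same column of `[C]` making up for `q` of them. -/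
theorem isLeast_valuesAt {p n m : ℕ} {K₁ : ℝ} (hK₁ : 0 ≤ K₁) (K₂ : ℝ)
    {𝓕 : (m : ℕ) → Set (Attack n m)} (hpm : p ≤ m) (hmn : m ≤ n) (q : ℕ)
    (hlow : ∀ N : Network n, N.IsAdmissible → N.IsRobust 𝓕 → ∀ j,
      p + 1 ≤ (Finset.univ.filter fun i => N.A i j = true).card +
        q * (Finset.univ.filter fun i => N.C i j = true).card)
    {A : StructMatrix (Fin n) (Fin n)} (hA : ∀ i, A i i = true)
    (hR : Network.IsRobust ⟨m, A, firstSensors n m⟩ 𝓕)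
    (hcol : ∀ j, (Finset.univ.filter fun i => A i j = true).card +
        q * (Finset.univ.filter fun i => firstSensors n m i j = true).card = p + 1) :
    IsLeast (valuesAt p n m K₁ K₂ 𝓕)
      (K₁ * ((n : ℝ) * ((p : ℝ) + 1)) + (K₂ - K₁ * (q : ℝ)) * (m : ℝ)) := by
  have hadm := isAdmissible_firstSensors hmn hA
  constructor
  · refine ⟨⟨m, A, firstSensors n m⟩, ⟨hadm, hR, hpm, hmn⟩, rfl, ?_⟩
    have h : A.zeroNorm + q * m = n * (p + 1) := by
      have hs := Finset.sum_congr rfl fun j (_ : j ∈ Finset.univ) => hcol j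
      rw [Finset.sum_add_distrib, ← Finset.mul_sum, ← StructMatrix.zeroNorm_eq_sum_col,
        ← StructMatrix.zeroNorm_eq_sum_col, hadm.zeroNorm_C] at hs
      simpa using hs
    have h' : (A.zeroNorm : ℝ) + q * m = n * (p + 1) := by exact_mod_cast h
    rw [cost, ← h']
    ring
  · rintro c ⟨N, ⟨hN, hNR, -, -⟩, rfl, rfl⟩
    have h : n * (p + 1) ≤ N.A.zeroNorm + q * N.m := by
      have hs := Finset.sum_le_sum fun j (_ : j ∈ Finset.univ) => hlow N hN hNR j
      rw [Finset.sum_add_distrib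
        (f := fun j => (Finset.univ.filter fun i => N.A i j = true).card),
        ← Finset.mul_sum, ← StructMatrix.zeroNorm_eq_sum_col,
        ← StructMatrix.zeroNorm_eq_sum_col, hN.zeroNorm_C] at hs
      simpa using hs
    have h' : (n : ℝ) * (p + 1) ≤ N.A.zeroNorm + q * N.m := by exact_mod_cast h
    have := mul_le_mul_of_nonneg_left h' hK₁
    rw [cost]
    linarith

section Joint

variable {p n : ℕ} {K₁ K₂ : ℝ} {𝓕 : (m : ℕ) → Set (Attack n m)} {g : ℕ → ℝ}

theorem isLeast_values_iff
    (h : ∀ m ∈ Set.Icc p n, IsLeast (valuesAt p n m K₁ K₂ 𝓕) (g m)) (c : ℝ) :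
    IsLeast (values p n K₁ K₂ 𝓕) c ↔ IsLeast (g '' Set.Icc p n) c := by
  have hge : ∀ N ∈ feasible p n 𝓕, g N.m ≤ cost K₁ K₂ N := fun N hN =>
    (h N.m hN.2.2).2 ⟨N, hN, rfl, rfl⟩
  have hmem : ∀ m ∈ Set.Icc p n, g m ∈ values p n K₁ K₂ 𝓕 := by
    intro m hm
    obtain ⟨N, hN, -, hc⟩ := (h m hm).1
    exact ⟨N, hN, hc⟩
  constructor
  · rintro ⟨⟨N, hN, rfl⟩, hlb⟩
    refine ⟨⟨N.m, hN.2.2, (hge N hN).antisymm (hlb (hmem _ hN.2.2))⟩, ?_⟩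
    rintro _ ⟨m, hm, rfl⟩
    exact hlb (hmem m hm)
  · rintro ⟨⟨m, hm, rfl⟩, hlb⟩
    refine ⟨hmem m hm, ?_⟩
    rintro _ ⟨N, hN, rfl⟩
    exact (hlb ⟨N.m, hN.2.2, rfl⟩).trans (hge N hN)

theorem mem_optimalCounts_iff
    (h : ∀ m ∈ Set.Icc p n, IsLeast (valuesAt p n m K₁ K₂ 𝓕) (g m)) (m : ℕ) :
    m ∈ optimalCounts p n K₁ K₂ 𝓕 ↔ m ∈ Set.Icc p n ∧ ∀ m' ∈ Set.Icc p n, g m ≤ g m' := by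
  constructor
  · rintro ⟨N, hN, rfl, hopt⟩
    refine ⟨hN.2.2, fun m' hm' => ?_⟩
    obtain ⟨N', hN', -, hc⟩ := (h m' hm').1
    exact ((h N.m hN.2.2).2 ⟨N, hN, rfl, rfl⟩).trans ((hopt N' hN').trans hc.ge)
  · rintro ⟨hm, hopt⟩
    obtain ⟨N, hN, hNm, hc⟩ := (h m hm).1
    refine ⟨N, hN, hNm, fun N' hN' => ?_⟩
    exact hc.ge.trans ((hopt _ hN'.2.2).trans ((h _ hN'.2.2).2 ⟨N', hN', rfl, rfl⟩))

theorem optimalCounts_eq_of_affine {a b : ℝ} (hpn : p ≤ n)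
    (h : ∀ m ∈ Set.Icc p n, IsLeast (valuesAt p n m K₁ K₂ 𝓕) (a + b * (m : ℝ))) :
    (0 < b → optimalCounts p n K₁ K₂ 𝓕 = {p}) ∧ (b < 0 → optimalCounts p n K₁ K₂ 𝓕 = {n}) ∧
      (b = 0 → optimalCounts p n K₁ K₂ 𝓕 = Set.Icc p n) := by
  refine ⟨fun hb => ?_, fun hb => ?_, fun hb => ?_⟩ <;> ext m <;>
    rw [mem_optimalCounts_iff h] <;>
    simp only [add_le_add_iff_left, Set.mem_singleton_iff]
  · simp only [mul_le_mul_iff_right₀ hb, Nat.cast_le]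
    constructor
    · rintro ⟨hm, hopt⟩
      exact (hopt p ⟨le_rfl, hpn⟩).antisymm hm.1
    · rintro rfl
      exact ⟨⟨le_rfl, hpn⟩, fun m' hm' => hm'.1⟩
  · simp only [mul_le_mul_left_of_neg hb, Nat.cast_le]
    constructor
    · rintro ⟨hm, hopt⟩
      exact hm.2.antisymm (hopt n ⟨hpn, le_rfl⟩)
    · rintro rfl
      exact ⟨⟨hpn, le_rfl⟩, fun m' hm' => hm'.2⟩
  · simp [hb]

end Joint

end DCS

theorem mainTheorem6 (n p : ℕ) (hp : 1 ≤ p) (hpn : p ≤ n) (K₁ K₂ : ℝ) (hK₁ : 0 ≤ K₁) :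
    -- attacks on at most `p` agents and observers
    ((∀ m ∈ Set.Icc p n,
        IsLeast (DCS.valuesAt p n m K₁ K₂ (DCS.attacksXY p n))
          (K₁ * ((n : ℝ) * ((p : ℝ) + 1)) + (K₂ - K₁) * (m : ℝ))) ∧
      (∀ c : ℝ, IsLeast (DCS.values p n K₁ K₂ (DCS.attacksXY p n)) c ↔
        IsLeast ((fun m : ℕ => K₁ * ((n : ℝ) * ((p : ℝ) + 1)) + (K₂ - K₁) * (m : ℝ)) ''
          Set.Icc p n) c) ∧
      (K₁ < K₂ → DCS.optimalCounts p n K₁ K₂ (DCS.attacksXY p n) = {p}) ∧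
      (K₂ < K₁ → DCS.optimalCounts p n K₁ K₂ (DCS.attacksXY p n) = {n}) ∧
      (K₂ = K₁ → DCS.optimalCounts p n K₁ K₂ (DCS.attacksXY p n) = Set.Icc p n)) ∧
    -- attacks on at most `p` agents only
    ((∀ m ∈ Set.Icc p n,
        IsLeast (DCS.valuesAt p n m K₁ K₂ (DCS.attacksX p n))
          (K₁ * ((n : ℝ) * ((p : ℝ) + 1)) + (K₂ - K₁ * (p : ℝ)) * (m : ℝ))) ∧
      (∀ c : ℝ, IsLeast (DCS.values p n K₁ K₂ (DCS.attacksX p n)) c ↔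
        IsLeast ((fun m : ℕ => K₁ * ((n : ℝ) * ((p : ℝ) + 1)) + (K₂ - K₁ * (p : ℝ)) * (m : ℝ)) ''
          Set.Icc p n) c) ∧
      (K₁ * (p : ℝ) < K₂ → DCS.optimalCounts p n K₁ K₂ (DCS.attacksX p n) = {p}) ∧
      (K₂ < K₁ * (p : ℝ) → DCS.optimalCounts p n K₁ K₂ (DCS.attacksX p n) = {n}) ∧
      (K₂ = K₁ * (p : ℝ) → DCS.optimalCounts p n K₁ K₂ (DCS.attacksX p n) = Set.Icc p n)) := by
  have hXY : ∀ m ∈ Set.Icc p n, IsLeast (DCS.valuesAt p n m K₁ K₂ (DCS.attacksXY p n))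
      (K₁ * ((n : ℝ) * ((p : ℝ) + 1)) + (K₂ - K₁) * (m : ℝ)) := fun m hm => by
    -- An attackable sensor replaces one link, so `q = 1`; in `hX` a secure sensor replaces `p`
    -- links.
    simpa using DCS.isLeast_valuesAt hK₁ K₂ hm.1 hm.2 1
      (fun N hN hR j => by simpa using hN.le_card_col_of_isRobust_attacksXY hR j)
      (fun i => by simp [DCS.hubLinksXY]) (DCS.isRobust_hubLinksXY hp hm.1 hm.2)
      (fun j => by simpa using DCS.card_col_hubLinksXY hp hm.1 hm.2 j)
  have hX : ∀ m ∈ Set.Icc p n, IsLeast (DCS.valuesAt p n m K₁ K₂ (DCS.attacksX p n))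
      (K₁ * ((n : ℝ) * ((p : ℝ) + 1)) + (K₂ - K₁ * (p : ℝ)) * (m : ℝ)) := fun m hm =>
    DCS.isLeast_valuesAt hK₁ K₂ hm.1 hm.2 p
      (fun N hN hR j => hN.le_card_col_of_isRobust_attacksX hR j)
      (fun i => by simp [DCS.hubLinksX]) (DCS.isRobust_hubLinksX hm.1 hm.2)
      (DCS.card_col_hubLinksX hm.1 hm.2)
  obtain ⟨h1, h2, h3⟩ := DCS.optimalCounts_eq_of_affine hpn hXY
  obtain ⟨h4, h5, h6⟩ := DCS.optimalCounts_eq_of_affine hpn hX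
  exact ⟨⟨hXY, DCS.isLeast_values_iff hXY, fun h => h1 (sub_pos.2 h), fun h => h2 (sub_neg.2 h),
      fun h => h3 (sub_eq_zero.2 h)⟩,
    hX, DCS.isLeast_values_iff hX, fun h => h4 (sub_pos.2 h), fun h => h5 (sub_neg.2 h),
      fun h => h6 (sub_eq_zero.2 h)⟩
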